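/- All actions on metric spaces are by isometries. A hyperbolic space is a geodesic metric space $S$, not necessarily proper, for which there is $\delta\ge 0$ such that each side of each geodesic triangle lies in the $\delta$-neighbourhood of the union of the other two. Let $\partial S$ denote its Gromov boundary (equivalence classes of sequences converging at infinity). For a group $G$ acting on $S$, the limit set $\Lambda(G)\subseteq\partial S$ is the set of limits in $\partial S$ of sequences of points of a $G$-orbit in $S$. The action is non-elementary if $\Lambda(G)$ is infinite, and acylindrical if for every $\varepsilon>0$ there are $R,N>0$ such that for all $x,y\in S$ with $d(x,y)\ge R$ at most $N$ elements $g\in G$ satisfy $d(x,gx)\le\varepsilon$ and $d(y,gy)\le\varepsilon$. A group is acylindrically hyperbolic if it admits a non-elementary acylindrical action on a hyperbolic space. A subgroup $H\le G$ is geometrically dense with respect to an action of $G$ on $S$ if $H$ fixes no point of $\partial S$ and $\Lambda(H)=\Lambda(G)$; a subgroup $H$ of an acylindrically hyperbolic group $G$ is totally geometrically dense if it is geometrically dense with respect to every non-elementary acylindrical action of $G$ on a hyperbolic space. An invariant random subgroup (IRS) of $G$ is a Borel probability measure on the space of subgroups of $G$ (with the topology inherited from $\{0,1\}^G$) that is invariant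 under conjugation by $G$; it is ergodic if the conjugation action of $G$ is ergodic with respect to it. Let $G$ be a countable acylindrically hyperbolic group and let $\mu$ be an ergodic IRS of $G$. Then $G$ has a finite normal subgroup $K(G)$ that contains every finite normal subgroup of $G$, and at least one of the following holds: 1. $\mu$-almost every subgroup $H\le G$ is totally geometrically dense, and $\mu$-almost every subgroup $H\le G$ is acylindrically hyperbolic; 2. $\mu$-almost every subgroup $H\le G$ is contained in $K(G)$, and $\mu$-almost every subgroup $H\le G$ is finite. -/

import Mathlib

open MeasureTheory Filter
open scoped Pointwise

universe u v w

/-! ### Hyperbolic spaces -/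

section Hyperbolic

variable {S : Type v} [MetricSpace S]

/-- `σ` is (the image of) a geodesic segment from `x` to `y`. -/
def IsGeodesicSegment (x y : S) (σ : Set S) : Prop :=
  ∃ γ : ℝ → S, γ 0 = x ∧ γ (dist x y) = y ∧
    (∀ s ∈ Set.Icc 0 (dist x y), ∀ t ∈ Set.Icc 0 (dist x y), dist (γ s) (γ t) = |s - t|) ∧
    σ = γ '' Set.Icc 0 (dist x y)

variable (S) in
/-- A hyperbolic space: a geodesic metric space in which, for some `δ ≥ 0`, every side of every
geodesic triangle lies in the closed `δ`-neighbourhood of the union of the other two sides.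
No properness or completeness is assumed. -/
def IsHyperbolicSpace : Prop :=
  (∀ x y : S, ∃ σ : Set S, IsGeodesicSegment x y σ) ∧
  ∃ δ : ℝ, 0 ≤ δ ∧ ∀ (x y z : S) (σ₁ σ₂ σ₃ : Set S),
    IsGeodesicSegment x y σ₁ → IsGeodesicSegment y z σ₂ → IsGeodesicSegment z x σ₃ →
      ∀ p ∈ σ₁, ∃ q ∈ σ₂ ∪ σ₃, dist p q ≤ δ

/-- The Gromov product `(x, y)_z`. -/
noncomputable def gromovProduct (x y z : S) : ℝ :=
  (dist x z + dist y z - dist x y) / 2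

/-- `(x_i, y_j)_s → ∞` as `i, j → ∞`, for every base point `s`. -/
def AsymptoticAtInfinity (x y : ℕ → S) : Prop :=
  ∀ s : S, Tendsto (fun p : ℕ × ℕ => gromovProduct (x p.1) (y p.2) s) atTop atTop

variable (S) in
/-- Sequences in `S` that converge at infinity. -/
def SeqAtInfinity : Type v :=
  {x : ℕ → S // AsymptoticAtInfinity x x}

variable (S) in
/-- The Gromov boundary: sequences converging at infinity modulo equivalence. (For hyperbolic `S`
the relation `AsymptoticAtInfinity` is an equivalence relation on such sequences; `Quot` forms the
quotient by the equivalence relation it generates.) -/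
def GromovBoundary : Type v :=
  Quot fun x y : SeqAtInfinity S => AsymptoticAtInfinity x.1 y.1

end Hyperbolic

/-! ### Isometric actions on hyperbolic spaces -/

section Action

variable {G : Type u} [Group G] {S : Type v} [MetricSpace S] [MulAction G S]

theorem AsymptoticAtInfinity.smul [IsIsometricSMul G S] (g : G) {x y : ℕ → S}
    (h : AsymptoticAtInfinity x y) :
    AsymptoticAtInfinity (fun n => g • x n) (fun n => g • y n) := by
  intro s
  refine (h (g⁻¹ • s)).congr fun p => ?_
  have e : ∀ a : S, dist (g • a) s = dist a (g⁻¹ • s) := fun a => by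
    rw [← dist_smul g a (g⁻¹ • s), smul_inv_smul]
  simp only [gromovProduct, e, dist_smul]

/-- The induced action on the Gromov boundary: `g • [x_n] = [g • x_n]`. -/
instance GromovBoundary.instMulAction [IsIsometricSMul G S] : MulAction G (GromovBoundary S) where
  smul g := Quot.map (fun x => ⟨fun n => g • x.1 n, x.2.smul g⟩) fun _ _ h => h.smul g
  one_smul := by
    rintro ⟨x⟩
    exact congrArg (Quot.mk _) (Subtype.ext (funext fun n => one_smul G (x.1 n)))
  mul_smul := by
    rintro g h ⟨x⟩
    exact congrArg (Quot.mk _) (Subtype.ext (funext fun n => mul_smul g h (x.1 n)))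

variable (G S)

/-- The limit set: boundary points that are limits of sequences of points of a `G`-orbit. -/
def limitSet : Set (GromovBoundary S) :=
  {ξ | ∃ (s : S) (x : SeqAtInfinity S),
    (∀ n, x.1 n ∈ MulAction.orbit G s) ∧ (Quot.mk _ x : GromovBoundary S) = ξ}

/-- An action is non-elementary if its limit set is infinite. -/
def IsNonelementaryAction : Prop := (limitSet G S).Infinite

/-- Acylindricity of an action. -/
def IsAcylindricalAction : Prop :=
  ∀ ε : ℝ, 0 < ε → ∃ (R : ℝ) (N : ℕ), 0 < R ∧ 0 < N ∧ ∀ x y : S, R ≤ dist x y →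
    {g : G | dist x (g • x) ≤ ε ∧ dist y (g • y) ≤ ε}.encard ≤ N

end Action

/-- A group is acylindrically hyperbolic if it admits a non-elementary acylindrical isometric
action on a hyperbolic space. -/
def IsAcylindricallyHyperbolic (G : Type u) [Group G] : Prop :=
  ∃ (S : Type v) (_ : MetricSpace S) (_ : MulAction G S),
    IsIsometricSMul G S ∧ IsHyperbolicSpace S ∧
      IsNonelementaryAction G S ∧ IsAcylindricalAction G S

section Dense

variable {G : Type u} [Group G]

/-- `H` is geometrically dense with respect to the action of `G` on `S`: it fixes no point of the
boundary and has the same limit set as `G`. -/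
def IsGeometricallyDense (H : Subgroup G) (S : Type v) [MetricSpace S] [MulAction G S]
    [IsIsometricSMul G S] : Prop :=
  (¬ ∃ ξ : GromovBoundary S, ∀ h ∈ H, h • ξ = ξ) ∧ limitSet H S = limitSet G S

/-- `H` is geometrically dense with respect to every non-elementary acylindrical isometric action
of `G` on a hyperbolic space. -/
def IsTotallyGeometricallyDense (H : Subgroup G) : Prop :=
  ∀ (S : Type v) [MetricSpace S] [MulAction G S] [IsIsometricSMul G S],
    IsHyperbolicSpace S → IsNonelementaryAction G S → IsAcylindricalAction G S →
      IsGeometricallyDense H S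

end Dense

/-- The subgroup generated by all finite normal subgroups. It is the maximal finite normal subgroup
`K(G)` whenever the latter exists. -/
def finiteRadical (G : Type u) [Group G] : Subgroup G :=
  sSup {N : Subgroup G | N.Normal ∧ Finite N}

/-! ### The space of subgroups -/

section Sub

variable {G : Type u} [Group G]

open Classical in
/-- The topology on the set of subgroups of `G` inherited from the product topology on
`{0,1}^G`. -/
noncomputable instance Subgroup.instTopologicalSpaceSub : TopologicalSpace (Subgroup G) :=
  TopologicalSpace.induced (fun (H : Subgroup G) (g : G) => decide (g ∈ H)) inferInstance

/-- The Borel σ-algebra on the space of subgroups. -/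
noncomputable instance Subgroup.instMeasurableSpaceSub : MeasurableSpace (Subgroup G) :=
  borel (Subgroup G)

instance Subgroup.instBorelSpaceSub : BorelSpace (Subgroup G) := ⟨rfl⟩

/-- An ergodic invariant random subgroup of `G`: a Borel probability measure on the space of
subgroups, invariant and ergodic under the action of `G` by conjugation. -/
structure IsErgodicIRS (μ : Measure (Subgroup G)) : Prop where
  isProbabilityMeasure : IsProbabilityMeasure μ
  ergodicSMul : ErgodicSMul (ConjAct G) (Subgroup G) μ

end Sub

/-! ### Gromov products and the metric geometry of hyperbolic spaces. -/

section GromovProduct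

variable {S : Type v} [MetricSpace S]

/-! Randomness enters only through Poincaré recurrence and ergodicity. Since `G` is countable,
almost every `H` is recurrent (`ae_isConjRecurrent`): for `h ∈ H` and `g ∈ G`, infinitely many `g⁻ⁿ
h gⁿ` lie in `H`. This condition mentions no action, so one null set serves all actions at once, and
the rest is deterministic.

Fix an action and a loxodromic `g` with endpoints `g⁺`, `g⁻`. If `h` moves `g⁺`, then `g⁻ⁿ h gⁿ o`
tends to `g⁻`, so recurrence puts `g⁻` in the limit set of `H`. If instead `H` fixes a point `ξ ≠
g⁻`, then infinitely often `g⁻ⁿ h gⁿ` fixes `ξ`, so `h` fixes `gⁿ ξ`, which tends to `g⁺`; hence `h`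
fixes `g⁺`. If `ξ = g⁻`, acylindricity gives the same conclusion. So a recurrent `H` with a boundary
fixed point fixes all loxodromic endpoints.

The pointwise stabiliser of these endpoints is the largest finite normal subgroup, hence is `K(G)`
in every action. A recurrent `H` not inside `K(G)` therefore has no boundary fixed point and
accumulates on every loxodromic endpoint; these are dense in the limit set of `G`, so `H` is
geometrically dense. Ergodicity decides whether `H ≤ K(G)` almost surely or almost never, and
restricting one action of `G` to `H` gives acylindrical hyperbolicity. -/

theorem gromovProduct_comm (x y o : S) : gromovProduct x y o = gromovProduct y x o := by
  simp only [gromovProduct, dist_comm x y]; ring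

theorem gromovProduct_nonneg (x y o : S) : 0 ≤ gromovProduct x y o := by
  have := dist_triangle_right x y o
  simp only [gromovProduct]; linarith

theorem gromovProduct_le_dist_left (x y o : S) : gromovProduct x y o ≤ dist x o := by
  have := dist_triangle y x o
  simp only [gromovProduct, dist_comm x y]; linarith

theorem gromovProduct_base_le (x y o s : S) :
    gromovProduct x y o ≤ gromovProduct x y s + dist o s := by
  have h1 := dist_triangle x s o
  have h2 := dist_triangle y s o
  rw [dist_comm s o] at h1 h2
  simp only [gromovProduct]; linarith

theorem gromovProduct_left_le (x x' y o : S) :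
    gromovProduct x y o ≤ gromovProduct x' y o + dist x x' := by
  have h1 := dist_triangle x x' o
  have h2 := dist_triangle x' x y
  rw [dist_comm x' x] at h2
  simp only [gromovProduct]; linarith

theorem gromovProduct_right_le (x y y' o : S) :
    gromovProduct x y o ≤ gromovProduct x y' o + dist y y' := by
  rw [gromovProduct_comm x y, gromovProduct_comm x y']
  exact gromovProduct_left_le y y' x o

/-- The comparison tripod cuts the side `[o, y]` into these two lengths. A product bounded at one
end is thus nearly maximal at the other; this drives most base point changes below. -/
theorem gromovProduct_add_swap (x y o : S) :
    gromovProduct x y o + gromovProduct o x y = dist o y := by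
  simp only [gromovProduct, dist_comm o x, dist_comm y o]; ring

theorem gromovProduct_smul {G : Type u} [Group G] [MulAction G S] [IsIsometricSMul G S]
    (g : G) (x y o : S) :
    gromovProduct (g • x) (g • y) (g • o) = gromovProduct x y o := by
  simp only [gromovProduct, dist_smul]

variable (S) in
/-- The four-point (Gromov product) form of hyperbolicity. -/
def IsGromovHyperbolic (δ : ℝ) : Prop :=
  ∀ x y z o : S, min (gromovProduct x y o) (gromovProduct y z o) ≤ gromovProduct x z o + δ

/-! ### Thin triangles imply the four-point inequality -/

theorem IsGeodesicSegment.dist_add_dist {x y p : S} {σ : Set S} (h : IsGeodesicSegment x y σ)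
    (hp : p ∈ σ) : dist x p + dist p y = dist x y := by
  obtain ⟨γ, h0, h1, hγ, rfl⟩ := h
  obtain ⟨t, ht, rfl⟩ := hp
  have a := hγ 0 ⟨le_rfl, dist_nonneg⟩ t ht
  have b := hγ t ht _ ⟨dist_nonneg, le_rfl⟩
  rw [h0] at a
  rw [h1] at b
  rw [a, b, abs_of_nonpos (by linarith [ht.1]), abs_of_nonpos (by linarith [ht.2])]
  ring

theorem IsGeodesicSegment.isCompact_isPreconnected {x y : S} {σ : Set S}
    (h : IsGeodesicSegment x y σ) : IsCompact σ ∧ IsPreconnected σ ∧ x ∈ σ ∧ y ∈ σ := by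
  obtain ⟨γ, h0, h1, hγ, rfl⟩ := h
  have hc : ContinuousOn γ (Set.Icc 0 (dist x y)) := by
    refine (LipschitzOnWith.of_dist_le_mul (K := 1) fun s hs t ht => ?_).continuousOn
    rw [hγ s hs t ht, NNReal.coe_one, one_mul, Real.dist_eq]
  exact ⟨isCompact_Icc.image_of_continuousOn hc, isPreconnected_Icc.image _ hc,
    ⟨0, ⟨le_rfl, dist_nonneg⟩, h0⟩, ⟨_, ⟨dist_nonneg, le_rfl⟩, h1⟩⟩

theorem IsGeodesicSegment.gromovProduct_le {x y p : S} {σ : Set S} (h : IsGeodesicSegment x y σ)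
    (hp : p ∈ σ) (o : S) : gromovProduct x y o ≤ dist o p := by
  have h1 := h.dist_add_dist hp
  have h2 := dist_triangle x p o
  have h3 := dist_triangle y p o
  rw [dist_comm p o] at h2 h3
  rw [dist_comm y p] at h3
  simp only [gromovProduct]; linarith

/-- The connected side `σ₁` is covered by the closed `δ`-neighbourhoods of the other two sides, each
containing an endpoint; some `p` lies in both. -/
theorem exists_mem_dist_le_gromovProduct {δ : ℝ} (hδ : 0 ≤ δ) {x y o : S} {σ₁ σ₂ σ₃ : Set S}
    (h₁ : IsGeodesicSegment x y σ₁) (h₂ : IsGeodesicSegment y o σ₂)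
    (h₃ : IsGeodesicSegment o x σ₃) (hs : ∀ p ∈ σ₁, ∃ q ∈ σ₂ ∪ σ₃, dist p q ≤ δ) :
    ∃ p ∈ σ₁, dist o p ≤ gromovProduct x y o + 2 * δ := by
  obtain ⟨-, c1, x1, y1⟩ := h₁.isCompact_isPreconnected
  obtain ⟨k2, -, y2, -⟩ := h₂.isCompact_isPreconnected
  obtain ⟨k3, -, -, x3⟩ := h₃.isCompact_isPreconnected
  have key := isPreconnected_closed_iff.1 c1 (Metric.cthickening δ σ₂) (Metric.cthickening δ σ₃)
    Metric.isClosed_cthickening Metric.isClosed_cthickening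
    (fun p hp => by
      obtain ⟨q, hq | hq, hpq⟩ := hs p hp
      · exact Or.inl (Metric.mem_cthickening_of_dist_le p q δ _ hq hpq)
      · exact Or.inr (Metric.mem_cthickening_of_dist_le p q δ _ hq hpq))
    ⟨y, y1, Metric.self_subset_cthickening _ y2⟩ ⟨x, x1, Metric.self_subset_cthickening _ x3⟩
  obtain ⟨p, hp, hp2, hp3⟩ := key
  rw [k2.cthickening_eq_biUnion_closedBall hδ] at hp2
  rw [k3.cthickening_eq_biUnion_closedBall hδ] at hp3
  simp only [Set.mem_iUnion, Metric.mem_closedBall, exists_prop] at hp2 hp3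
  obtain ⟨q, hq, hpq⟩ := hp2
  obtain ⟨r, hr, hpr⟩ := hp3
  refine ⟨p, hp, ?_⟩
  have e1 := h₁.dist_add_dist hp
  have e2 := h₂.dist_add_dist hq
  have e3 := h₃.dist_add_dist hr
  have t1 := dist_triangle p q o
  have t2 := dist_triangle p r o
  have t3 := dist_triangle y q p
  have t4 := dist_triangle x r p
  simp only [gromovProduct]
  rw [dist_comm q p, dist_comm y p] at t3
  rw [dist_comm r p, dist_comm x r] at t4
  rw [dist_comm r o] at t2
  rw [dist_comm o p, dist_comm x o]
  linarith

/-- A point of `[x, z]` within `(x, z)_o + 2δ` of `o` is `δ`-close to `[z, y]` or `[y, x]`, and the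
distance from `o` to a side bounds that side's product. Hence `3δ`. -/
theorem IsHyperbolicSpace.exists_isGromovHyperbolic (h : IsHyperbolicSpace S) :
    ∃ δ : ℝ, 0 ≤ δ ∧ IsGromovHyperbolic S δ := by
  obtain ⟨hg, δ, hδ, hs⟩ := h
  refine ⟨3 * δ, by linarith, fun x y z o => ?_⟩
  obtain ⟨σxz, hxz⟩ := hg x z
  obtain ⟨σzo, hzo⟩ := hg z o
  obtain ⟨σox, hox⟩ := hg o x
  obtain ⟨σzy, hzy⟩ := hg z y
  obtain ⟨σyx, hyx⟩ := hg y x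
  obtain ⟨p, hp, hop⟩ := exists_mem_dist_le_gromovProduct hδ hxz hzo hox
    (hs _ _ _ _ _ _ hxz hzo hox)
  obtain ⟨q, hq | hq, hpq⟩ := hs _ _ _ _ _ _ hxz hzy hyx p hp
  · refine (min_le_right _ _).trans ?_
    have := hzy.gromovProduct_le hq o
    rw [gromovProduct_comm] at this
    linarith [dist_triangle o p q]
  · refine (min_le_left _ _).trans ?_
    have := hyx.gromovProduct_le hq o
    rw [gromovProduct_comm] at this
    linarith [dist_triangle o p q]

/-- The four-point inequality in terms of distances. -/
theorem IsGromovHyperbolic.dist_add_dist_le {δ : ℝ} (hδ : IsGromovHyperbolic S δ) (a b c d : S) :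
    dist a b + dist c d ≤ max (dist a c + dist b d) (dist a d + dist b c) + 2 * δ := by
  have := hδ a c b d
  rw [dist_comm b c]
  simp only [gromovProduct] at this
  rcases min_le_iff.1 this with h | h
  · exact le_trans (by linarith) (add_le_add_left (le_max_left _ _) _)
  · exact le_trans (by linarith) (add_le_add_left (le_max_right _ _) _)

theorem IsGromovHyperbolic.le_gromovProduct {δ M : ℝ} (hδ : IsGromovHyperbolic S δ) {x z o : S}
    (y : S) (h1 : M + δ ≤ gromovProduct x y o) (h2 : M + δ ≤ gromovProduct y z o) :
    M ≤ gromovProduct x z o := by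
  linarith [hδ x y z o, le_min h1 h2]

/-! ### Sequences converging at infinity -/

theorem asymptoticAtInfinity_iff (o : S) (x y : ℕ → S) :
    AsymptoticAtInfinity x y ↔
      ∀ M : ℝ, ∃ N : ℕ, ∀ i ≥ N, ∀ j ≥ N, M ≤ gromovProduct (x i) (y j) o := by
  have key : ∀ s : S, Tendsto (fun p : ℕ × ℕ => gromovProduct (x p.1) (y p.2) s) atTop atTop ↔
      ∀ M : ℝ, ∃ N : ℕ, ∀ i ≥ N, ∀ j ≥ N, M ≤ gromovProduct (x i) (y j) s := fun s => by
    rw [tendsto_atTop_atTop]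
    refine forall_congr' fun M => ⟨fun ⟨⟨a, b⟩, h⟩ => ⟨max a b, fun i hi j hj => ?_⟩,
      fun ⟨N, h⟩ => ⟨(N, N), fun ⟨i, j⟩ hij => h i hij.1 j hij.2⟩⟩
    exact h (i, j) ⟨(le_max_left a b).trans hi, (le_max_right a b).trans hj⟩
  refine ⟨fun h => (key o).1 (h o), fun h s => (key s).2 fun M => ?_⟩
  obtain ⟨N, hN⟩ := h (M + dist o s)
  exact ⟨N, fun i hi j hj => by linarith [hN i hi j hj, gromovProduct_base_le (x i) (y j) o s]⟩

theorem AsymptoticAtInfinity.symm {x y : ℕ → S} (h : AsymptoticAtInfinity x y) :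
    AsymptoticAtInfinity y x := by
  have o := x 0
  rw [asymptoticAtInfinity_iff o] at h ⊢
  intro M
  obtain ⟨N, hN⟩ := h M
  exact ⟨N, fun i hi j hj => by rw [gromovProduct_comm]; exact hN j hj i hi⟩

theorem AsymptoticAtInfinity.trans {δ : ℝ} (hδ : IsGromovHyperbolic S δ) {x y z : ℕ → S}
    (h1 : AsymptoticAtInfinity x y) (h2 : AsymptoticAtInfinity y z) :
    AsymptoticAtInfinity x z := by
  have o := x 0
  rw [asymptoticAtInfinity_iff o] at *
  intro M
  obtain ⟨N, hN⟩ := h1 (M + δ)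
  obtain ⟨N', hN'⟩ := h2 (M + δ)
  refine ⟨max N N', fun i hi j hj => hδ.le_gromovProduct (y (max N N')) ?_ ?_⟩
  · exact hN i ((le_max_left _ _).trans hi) _ (le_max_left _ _)
  · exact hN' _ (le_max_right _ _) j ((le_max_right _ _).trans hj)

theorem gromovBoundary_mk_eq_iff {δ : ℝ} (hδ : IsGromovHyperbolic S δ) (x y : SeqAtInfinity S) :
    (Quot.mk _ x : GromovBoundary S) = Quot.mk _ y ↔ AsymptoticAtInfinity x.1 y.1 := by
  refine Equivalence.quot_mk_eq_iff (r := fun x y : SeqAtInfinity S =>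
    AsymptoticAtInfinity x.1 y.1) ⟨fun x => x.2, fun h => h.symm, fun h h' => h.trans hδ h'⟩ x y

/-- Two sequences converging to distinct boundary points have bounded Gromov products. -/
theorem gromovProduct_le_of_not_asymptotic {δ : ℝ} (hδ : IsGromovHyperbolic S δ) (o : S)
    {x y : ℕ → S} (hx : AsymptoticAtInfinity x x) (hy : AsymptoticAtInfinity y y)
    (h : ¬ AsymptoticAtInfinity x y) :
    ∃ (B : ℝ) (N : ℕ), ∀ i ≥ N, ∀ j ≥ N, gromovProduct (x i) (y j) o ≤ B := by
  rw [asymptoticAtInfinity_iff o] at *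
  push Not at h
  obtain ⟨M, hM⟩ := h
  obtain ⟨N, hN⟩ := hx (M + 2 * δ)
  obtain ⟨N', hN'⟩ := hy (M + δ)
  refine ⟨M + 2 * δ, max N N', fun i hi j hj => ?_⟩
  -- A single late pair with product above `M + 2δ` would force product at least `M` on every late
  -- pair, at a cost of `δ` for each of two four-point inequalities.
  by_contra! hlt
  obtain ⟨i', hi', j', hj', hij⟩ := hM (max N N')
  refine hij.not_ge (hδ.le_gromovProduct (y j) (hδ.le_gromovProduct (x i) ?_ (by linarith)) ?_)
  · linarith [hN i' ((le_max_left _ _).trans hi') i ((le_max_left _ _).trans hi)]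
  · exact hN' j ((le_max_right _ _).trans hj) j' ((le_max_right _ _).trans hj')

/-- Sequences converging at infinity that are frequently at bounded distance are asymptotic. -/
theorem asymptotic_of_frequently_le {δ : ℝ} (hδ : IsGromovHyperbolic S δ) (o : S)
    {x y : ℕ → S} (hx : AsymptoticAtInfinity x x) (hy : AsymptoticAtInfinity y y)
    (h : ∀ M : ℝ, ∀ N : ℕ, ∃ i ≥ N, ∃ j ≥ N, M ≤ gromovProduct (x i) (y j) o) :
    AsymptoticAtInfinity x y := by
  by_contra hn
  obtain ⟨B, N, hB⟩ := gromovProduct_le_of_not_asymptotic hδ o hx hy hn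
  obtain ⟨i, hi, j, hj, hij⟩ := h (B + 1) N
  linarith [hB i hi j hj]

end GromovProduct

/-! ### Loxodromic elements and their existence. -/

section Loxodromic

variable {G : Type u} [Group G] {S : Type v} [MetricSpace S] [MulAction G S] [IsIsometricSMul G S]

theorem AsymptoticAtInfinity.of_dist_le_left {x x' y : ℕ → S} {C : ℝ}
    (h : AsymptoticAtInfinity x y) (hC : ∀ n, dist (x n) (x' n) ≤ C) :
    AsymptoticAtInfinity x' y := by
  have o := x 0
  rw [asymptoticAtInfinity_iff o] at *
  intro M
  obtain ⟨N, hN⟩ := h (M + C)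
  exact ⟨N, fun i hi j hj => by
    linarith [hN i hi j hj, gromovProduct_left_le (x i) (x' i) (y j) o, hC i]⟩

theorem AsymptoticAtInfinity.of_dist_le_right {x y y' : ℕ → S} {C : ℝ}
    (h : AsymptoticAtInfinity x y) (hC : ∀ n, dist (y n) (y' n) ≤ C) :
    AsymptoticAtInfinity x y' :=
  (h.symm.of_dist_le_left hC).symm

theorem mem_limitSet_iff (o : S) (ξ : GromovBoundary S) :
    ξ ∈ limitSet G S ↔ ∃ (a : ℕ → G) (x : SeqAtInfinity S),
      (∀ n, x.1 n = a n • o) ∧ (Quot.mk _ x : GromovBoundary S) = ξ := by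
  constructor
  · rintro ⟨s, x, hx, rfl⟩
    choose a ha using hx
    have hd : ∀ n, dist (x.1 n) (a n • o) ≤ dist s o := fun n => by
      rw [← ha n]; exact (dist_smul (a n) s o).le
    exact ⟨a, ⟨fun n => a n • o, (x.2.of_dist_le_left hd).of_dist_le_right hd⟩, fun n => rfl,
      Quot.sound (x.2.of_dist_le_left hd)⟩
  · rintro ⟨a, x, hx, rfl⟩
    exact ⟨o, x, fun n => ⟨a n, (hx n).symm⟩, rfl⟩

theorem gromovProduct_smul_smul (g : G) (x y o : S) :
    gromovProduct (g • x) (g • y) o = gromovProduct x y (g⁻¹ • o) := by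
  rw [← gromovProduct_smul g x y (g⁻¹ • o), smul_inv_smul]

theorem dist_smul_left_eq (g : G) (x y : S) : dist (g • x) y = dist x (g⁻¹ • y) := by
  rw [← dist_smul g x (g⁻¹ • y), smul_inv_smul]

/-- `g` acts loxodromically: the two half-orbits of `o` under `g` go to infinity in different
directions. -/
def IsLoxodromicAt (o : S) (g : G) : Prop :=
  (∃ A : ℝ, ∀ m n : ℕ, gromovProduct (g ^ m • o) (g⁻¹ ^ n • o) o ≤ A) ∧
    Tendsto (fun n : ℕ => dist (g ^ n • o) o) atTop atTop

namespace IsLoxodromicAt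

variable {o : S} {g : G}

theorem inv (h : IsLoxodromicAt o g) : IsLoxodromicAt o g⁻¹ := by
  obtain ⟨⟨A, hA⟩, ht⟩ := h
  refine ⟨⟨A, fun m n => ?_⟩, ?_⟩
  · rw [inv_inv, gromovProduct_comm]; exact hA n m
  · refine ht.congr fun n => ?_
    rw [dist_smul_left_eq, dist_comm, inv_pow]

theorem conj (h : IsLoxodromicAt o g) (a : G) : IsLoxodromicAt o (a * g * a⁻¹) := by
  obtain ⟨⟨A, hA⟩, ht⟩ := h
  have key : ∀ k : G, dist ((a * k * a⁻¹) • o) (a • k • o) = dist (a⁻¹ • o) o := fun k => by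
    simp only [mul_smul, dist_smul]
  have hd : dist (a • o) o = dist (a⁻¹ • o) o := by rw [dist_smul_left_eq, dist_comm]
  -- Two of the three terms replace the orbit points by `a gᵐ o` and `a g⁻ⁿ o`; the third moves the
  -- base point from `o` to `a o`.
  refine ⟨⟨A + 3 * dist (a⁻¹ • o) o, fun m n => ?_⟩, ?_⟩
  · have e : (a * g * a⁻¹)⁻¹ ^ n = a * g⁻¹ ^ n * a⁻¹ := by
      rw [← conj_pow]; group
    rw [e, conj_pow]
    have h1 := gromovProduct_left_le ((a * g ^ m * a⁻¹) • o) (a • g ^ m • o)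
      ((a * g⁻¹ ^ n * a⁻¹) • o) o
    have h2 := gromovProduct_right_le (a • g ^ m • o) ((a * g⁻¹ ^ n * a⁻¹) • o)
      (a • g⁻¹ ^ n • o) o
    have h3 := gromovProduct_base_le (a • g ^ m • o) (a • g⁻¹ ^ n • o) o (a • o)
    rw [gromovProduct_smul, dist_comm o] at h3
    rw [key] at h1 h2
    linarith [hA m n]
  · refine tendsto_atTop_mono (fun n => ?_)
      (tendsto_atTop_add_const_right _ (-(2 * dist (a⁻¹ • o) o)) ht)
    rw [conj_pow]
    have h1 := dist_triangle_left (a • g ^ n • o) o ((a * g ^ n * a⁻¹) • o)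
    rw [key] at h1
    have h4 := dist_triangle (a • g ^ n • o) o (a • o)
    rw [dist_smul, dist_comm o (a • o)] at h4
    linarith

/-- Translating by `g⁻ᵐ` shows that `gᵐ o` lies, up to `A`, between `o` and `gⁿ o`. -/
theorem dist_sub_le_gromovProduct {A : ℝ}
    (hA : ∀ m n : ℕ, gromovProduct (g ^ m • o) (g⁻¹ ^ n • o) o ≤ A) {m n : ℕ} (hmn : m ≤ n) :
    dist (g ^ m • o) o - A ≤ gromovProduct (g ^ n • o) (g ^ m • o) o := by
  have h1 := gromovProduct_add_swap (g ^ n • o) (g ^ m • o) o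
  have h2 : gromovProduct o (g ^ n • o) (g ^ m • o) =
      gromovProduct (g ^ (n - m) • o) (g⁻¹ ^ m • o) o := by
    rw [gromovProduct_comm, ← gromovProduct_smul (g ^ m) (g ^ (n - m) • o), ← mul_smul, ← mul_smul,
      ← pow_add,
      Nat.add_sub_cancel' hmn]
    simp
  rw [h2] at h1
  rw [dist_comm]
  linarith [hA (n - m) m]

theorem asymptotic (h : IsLoxodromicAt o g) :
    AsymptoticAtInfinity (fun n : ℕ => g ^ n • o) (fun n : ℕ => g ^ n • o) := by
  obtain ⟨⟨A, hA⟩, ht⟩ := h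
  rw [asymptoticAtInfinity_iff o]
  intro M
  obtain ⟨N, hN⟩ := tendsto_atTop_atTop.1 ht (M + A)
  refine ⟨N, fun i hi j hj => ?_⟩
  rcases le_total i j with hij | hij
  · rw [gromovProduct_comm]
    linarith [dist_sub_le_gromovProduct hA hij, hN i hi]
  · linarith [dist_sub_le_gromovProduct hA hij, hN j hj]

/-- The attracting fixed point of a loxodromic element. -/
def attracting (h : IsLoxodromicAt o g) : GromovBoundary S :=
  Quot.mk _ ⟨fun n : ℕ => g ^ n • o, h.asymptotic⟩

theorem smul_attracting (h : IsLoxodromicAt o g) (a : G) :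
    a • h.attracting = (h.conj a).attracting := by
  refine Quot.sound ((h.asymptotic.smul a).of_dist_le_right (C := dist o (a⁻¹ • o)) fun n => ?_)
  simp only [conj_pow, mul_smul, dist_smul]
  exact le_rfl

theorem smul_attracting_eq_iff {δ : ℝ} (hδ : IsGromovHyperbolic S δ) (h : IsLoxodromicAt o g)
    (a : G) : a • h.attracting = h.attracting ↔
      AsymptoticAtInfinity (fun n : ℕ => a • g ^ n • o) (fun n : ℕ => g ^ n • o) :=
  gromovBoundary_mk_eq_iff hδ _ _

end IsLoxodromicAt

/-- If `g` moves `o` far compared with the backtracking of its orbit, then `g` is loxodromic. -/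
theorem isLoxodromicAt_of_gromovProduct_le {δ : ℝ} (hδ : IsGromovHyperbolic S δ) (hδ0 : 0 ≤ δ)
    {o : S} {g : G} {a : ℝ} (ha : gromovProduct (g • o) (g⁻¹ • o) o ≤ a)
    (hL : 2 * a + 4 * δ < dist (g • o) o) : IsLoxodromicAt o g := by
  have ha0 : 0 ≤ a := (gromovProduct_nonneg _ _ _).trans ha
  have hinv : ∀ n : ℕ, dist (g⁻¹ ^ n • o) o = dist (g ^ n • o) o := fun n => by
    rw [dist_smul_left_eq, dist_comm, inv_pow, inv_inv]
  have hinv1 : dist (g⁻¹ • o) o = dist (g • o) o := by simpa using hinv 1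
  have hstep : ∀ n : ℕ, dist (g ^ (n + 1) • o) o =
      dist (g ^ n • o) o + dist (g • o) o - 2 * gromovProduct (g⁻¹ • o) (g ^ n • o) o := fun n => by
    have : dist (g ^ (n + 1) • o) o = dist (g⁻¹ • o) (g ^ n • o) := by
      rw [pow_succ', mul_smul, dist_smul_left_eq, dist_comm]
    rw [this, gromovProduct, hinv1]; ring
  -- Inductively, the product of `gⁿ⁺¹ o` with `g o` is `dist (g • o) o` minus the previous
  -- backtracking, so exceeds `a + δ`. The four-point inequality then bounds the next backtracking.
  have key : ∀ n : ℕ, gromovProduct (g⁻¹ • o) (g ^ n • o) o ≤ a + δ := by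
    intro n
    induction n with
    | zero =>
      have : gromovProduct (g⁻¹ • o) (g ^ 0 • o) o = 0 := by simp [gromovProduct]
      linarith
    | succ n ih =>
      have h1 : gromovProduct (g ^ (n + 1) • o) (g • o) o =
          (dist (g ^ (n + 1) • o) o + dist (g • o) o - dist (g ^ n • o) o) / 2 := by
        rw [gromovProduct, pow_succ' g n, mul_smul, dist_smul g]
      have h2 := hδ (g⁻¹ • o) (g ^ (n + 1) • o) (g • o) o
      rw [gromovProduct_comm (g⁻¹ • o) (g • o)] at h2
      rcases min_le_iff.1 h2 with h | h
      · linarith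
      · linarith [hstep n]
  have hgrow : ∀ n : ℕ, (n : ℝ) * (dist (g • o) o - 2 * (a + δ)) ≤ dist (g ^ n • o) o := by
    intro n
    induction n with
    | zero => simp
    | succ n ih => push_cast; linarith [hstep n, key n]
  refine ⟨⟨a + 2 * δ, fun m n => ?_⟩, ?_⟩
  · cases n with
    | zero =>
      have : gromovProduct (g ^ m • o) (g⁻¹ ^ 0 • o) o = 0 := by simp [gromovProduct]
      linarith
    | succ n =>
      have h1 : gromovProduct (g⁻¹ ^ (n + 1) • o) (g⁻¹ • o) o =
          (dist (g ^ (n + 1) • o) o + dist (g • o) o - dist (g ^ n • o) o) / 2 := by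
        rw [gromovProduct, hinv, hinv1, pow_succ' g⁻¹ n, mul_smul, dist_smul, hinv]
      have h2 := hδ (g ^ m • o) (g⁻¹ ^ (n + 1) • o) (g⁻¹ • o) o
      rw [gromovProduct_comm (g ^ m • o) (g⁻¹ • o)] at h2
      rcases min_le_iff.1 h2 with h | h
      · linarith [key m]
      · linarith [key m, hstep n, key n]
  · exact tendsto_atTop_mono hgrow (tendsto_natCast_atTop_atTop.atTop_mul_const (by linarith))

/-- Two isometries moving `o` far in different directions generate a loxodromic element. -/
theorem exists_isLoxodromicAt_of_gromovProduct_le {δ : ℝ} (hδ : IsGromovHyperbolic S δ)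
    (hδ0 : 0 ≤ δ) {o : S} {a b : G} {C : ℝ} (hC : gromovProduct (a • o) (b • o) o ≤ C)
    (ha : 2 * C + 8 * δ + 1 ≤ dist (a • o) o) (hb : 2 * C + 8 * δ + 1 ≤ dist (b • o) o) :
    ∃ g : G, IsLoxodromicAt o g := by
  -- If `a` and `b` are not loxodromic, `a⁻¹ o` points roughly like `a o`, and `b⁻¹ o` like `b o`.
  -- Then `ab o` and `(ab)⁻¹ o` follow `a o` and `b⁻¹ o`, so they diverge and `ab` is loxodromic.
  by_contra! hn
  have hgp : ∀ g : G, 2 * C + 8 * δ + 1 ≤ dist (g • o) o →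
      C + 2 * δ < gromovProduct (g • o) (g⁻¹ • o) o := fun g hg => by
    by_contra! hle
    exact hn g (isLoxodromicAt_of_gromovProduct_le hδ hδ0 hle (by linarith))
  have h1 : gromovProduct (a⁻¹ • o) (b • o) o ≤ C + δ := by
    rcases min_le_iff.1 (hδ (a • o) (a⁻¹ • o) (b • o) o) with h | h
    · linarith [hgp a ha]
    · linarith
  have h2 : gromovProduct (a • o) (b⁻¹ • o) o ≤ C + δ := by
    rcases min_le_iff.1 (hδ (a • o) (b⁻¹ • o) (b • o) o) with h | h
    · linarith
    · rw [gromovProduct_comm] at h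
      linarith [hgp b hb]
  have e1 : dist ((a * b) • o) o =
      dist (a • o) o + dist (b • o) o - 2 * gromovProduct (a⁻¹ • o) (b • o) o := by
    have : dist ((a * b) • o) o = dist (a⁻¹ • o) (b • o) := by
      rw [mul_smul, dist_smul_left_eq, dist_comm]
    have hia : dist (a⁻¹ • o) o = dist (a • o) o := by
      rw [dist_smul_left_eq, inv_inv, dist_comm]
    rw [this, gromovProduct, hia]; ring
  have e2 : gromovProduct ((a * b) • o) (a • o) o + gromovProduct (a⁻¹ • o) (b • o) o =
      dist (a • o) o := by
    have := gromovProduct_add_swap ((a * b) • o) (a • o) o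
    rw [mul_smul] at this ⊢
    have e : gromovProduct o (a • b • o) (a • o) = gromovProduct (a⁻¹ • o) (b • o) o := by
      rw [← gromovProduct_smul a (a⁻¹ • o), smul_inv_smul]
    rw [← e, dist_comm, this]
  have e3 : gromovProduct ((a * b)⁻¹ • o) (b⁻¹ • o) o + gromovProduct (a⁻¹ • o) (b • o) o =
      dist (b • o) o := by
    have := gromovProduct_add_swap ((a * b)⁻¹ • o) (b⁻¹ • o) o
    have e : gromovProduct o ((a * b)⁻¹ • o) (b⁻¹ • o) = gromovProduct (a⁻¹ • o) (b • o) o := by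
      rw [gromovProduct_comm, ← gromovProduct_smul b, smul_inv_smul, ← mul_smul]
      simp
    rw [← e, this, dist_comm, dist_smul_left_eq, inv_inv, dist_comm]
  refine hn (a * b) (isLoxodromicAt_of_gromovProduct_le hδ hδ0 (a := C + 3 * δ) ?_ (by linarith))
  have h3 : gromovProduct (a • o) ((a * b)⁻¹ • o) o ≤ C + 2 * δ := by
    rcases min_le_iff.1 (hδ (a • o) ((a * b)⁻¹ • o) (b⁻¹ • o) o) with h | h
    · linarith
    · linarith
  rcases min_le_iff.1 (hδ (a • o) ((a * b) • o) ((a * b)⁻¹ • o) o) with h | h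
  · rw [gromovProduct_comm] at h; linarith
  · linarith

theorem exists_isLoxodromicAt {δ : ℝ} (hδ : IsGromovHyperbolic S δ) (hδ0 : 0 ≤ δ) (o : S)
    (h : (limitSet G S).Nontrivial) : ∃ g : G, IsLoxodromicAt o g := by
  obtain ⟨ξ, hξ, η, hη, hne⟩ := h
  obtain ⟨a, x, hx, rfl⟩ := (mem_limitSet_iff o ξ).1 hξ
  obtain ⟨b, y, hy, rfl⟩ := (mem_limitSet_iff o η).1 hη
  obtain ⟨C, N, hC⟩ := gromovProduct_le_of_not_asymptotic hδ o x.2 y.2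
    (fun h => hne ((gromovBoundary_mk_eq_iff hδ x y).2 h))
  obtain ⟨N₁, h₁⟩ := (asymptoticAtInfinity_iff o _ _).1 x.2 (2 * C + 8 * δ + 1)
  obtain ⟨N₂, h₂⟩ := (asymptoticAtInfinity_iff o _ _).1 y.2 (2 * C + 8 * δ + 1)
  have hi : N ≤ max N (max N₁ N₂) ∧ N₁ ≤ max N (max N₁ N₂) ∧ N₂ ≤ max N (max N₁ N₂) := by
    simp
  generalize max N (max N₁ N₂) = i at hi
  have p0 := hC i hi.1 i hi.1
  have p1 := h₁ i hi.2.1 i hi.2.1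
  have p2 := h₂ i hi.2.2 i hi.2.2
  rw [hx] at p0 p1
  rw [hy] at p0 p2
  exact exists_isLoxodromicAt_of_gromovProduct_le hδ hδ0 p0
    (p1.trans (gromovProduct_le_dist_left _ _ _)) (p2.trans (gromovProduct_le_dist_left _ _ _))

end Loxodromic

/-! ### Dynamics at loxodromic endpoints, acylindricity and recurrence. -/

section Dynamics

variable {G : Type u} [Group G] {S : Type v} [MetricSpace S] [MulAction G S] [IsIsometricSMul G S]
  {δ : ℝ} {o : S} {g : G}

namespace IsLoxodromicAt

/-- If `k` moves the attracting point of `g`, then `g⁻ⁿ k gⁿ o` converges to the repelling point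
of `g`. -/
theorem le_gromovProduct_conj (hδ : IsGromovHyperbolic S δ) (h : IsLoxodromicAt o g) {k : G}
    (hk : k • h.attracting ≠ h.attracting) (M : ℝ) :
    ∃ N : ℕ, ∀ n ≥ N, ∀ j ≥ n,
      M ≤ gromovProduct (((g ^ n)⁻¹ * k * g ^ n) • o) (g⁻¹ ^ j • o) o := by
  rw [Ne, h.smul_attracting_eq_iff hδ] at hk
  obtain ⟨B, N, hB⟩ := gromovProduct_le_of_not_asymptotic hδ o (h.asymptotic.smul k) h.asymptotic hk
  obtain ⟨⟨A, hA⟩, ht⟩ := h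
  obtain ⟨N', hN'⟩ := tendsto_atTop_atTop.1 ht (M + δ + |A| + |B|)
  refine ⟨max N N', fun n hn j hj => ?_⟩
  have hn1 := hB n ((le_max_left _ _).trans hn) n ((le_max_left _ _).trans hn)
  have hn2 := hN' n ((le_max_right _ _).trans hn)
  have e : gromovProduct (((g ^ n)⁻¹ * k * g ^ n) • o) (g⁻¹ ^ j • o) o =
      gromovProduct (k • g ^ n • o) (g⁻¹ ^ (j - n) • o) (g ^ n • o) := by
    obtain ⟨i, rfl⟩ := Nat.exists_eq_add_of_le hj
    rw [← gromovProduct_smul (g ^ n)]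
    simp only [smul_smul]
    congr 2
    · group
    · rw [pow_add, Nat.add_sub_cancel_left, inv_pow, inv_pow, mul_inv_cancel_left]
  rw [e]
  have h1 := gromovProduct_add_swap (k • g ^ n • o) (g ^ n • o) o
  have h2 := gromovProduct_add_swap (g⁻¹ ^ (j - n) • o) (g ^ n • o) o
  have h3 := hA n (j - n)
  rw [gromovProduct_comm] at h3
  rw [dist_comm o] at h1 h2
  -- After translation by `gⁿ`, both points lie in the direction of `o` as seen from `gⁿ o`.
  refine hδ.le_gromovProduct o ?_ ?_
  · rw [gromovProduct_comm]
    linarith [abs_nonneg A, le_abs_self B]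
  · linarith [abs_nonneg B, le_abs_self A]

/-- An isometry fixing the attracting point of `g` moves the points `gⁿ o` by a bounded amount. -/
theorem dist_smul_pow_le (hδ : IsGromovHyperbolic S δ) (hδ0 : 0 ≤ δ) (h : IsLoxodromicAt o g)
    {A : ℝ} (hA : ∀ m n : ℕ, gromovProduct (g ^ m • o) (g⁻¹ ^ n • o) o ≤ A) {k : G}
    (hk : k • h.attracting = h.attracting) (n : ℕ) :
    dist (g ^ n • o) (k • g ^ n • o) ≤ dist (k • o) o + 2 * A + 4 * δ := by
  rw [h.smul_attracting_eq_iff hδ, asymptoticAtInfinity_iff o] at hk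
  obtain ⟨N, hN⟩ := hk (dist (k • g ^ n • o) o + δ + 1)
  -- Take `p` far out on the orbit, with `p` and `k p` in the same direction and `x` nearly between
  -- `o` and `p`. Up to bounded error `k x` is no farther than `x` from `o` or from `p`, hence is
  -- close to `x`.
  have hM := hN (max n N) (le_max_right _ _) (max n N) (le_max_right _ _)
  have hmono := dist_sub_le_gromovProduct hA (le_max_left n N)
  generalize g ^ max n N • o = p at hM hmono
  generalize g ^ n • o = x at *
  have f1 := hδ.dist_add_dist_le (k • x) p (k • p) o
  have f2 := hδ.dist_add_dist_le x (k • x) o p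
  have t1 := dist_triangle (k • x) (k • o) o
  have t2 := dist_triangle_right (k • p) (k • o) o
  have t3 := dist_triangle_left p o (k • x)
  rw [dist_smul] at t1 t2 f1
  simp only [gromovProduct] at hM hmono
  rw [dist_comm p x] at hmono
  rw [dist_comm o p] at f2
  rw [dist_comm p (k • p)] at f1
  have f1' : dist (k • x) p + dist (k • p) o ≤ dist x p + dist p o + 2 * δ := by
    rcases max_choice (dist x p + dist p o) (dist (k • x) o + dist (k • p) p) with e | e
    · rwa [e] at f1
    · rw [e] at f1; linarith
  rcases max_choice (dist x o + dist (k • x) p) (dist x p + dist (k • x) o) with e | e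
  · rw [e] at f2; linarith
  · rw [e] at f2; linarith

/-- In an acylindrical action, an element fixing the attracting point of a loxodromic element
commutes with one of its nontrivial powers. -/
theorem exists_commute_pow (hδ : IsGromovHyperbolic S δ) (hδ0 : 0 ≤ δ)
    (hacyl : IsAcylindricalAction G S) (h : IsLoxodromicAt o g) {k : G}
    (hk : k • h.attracting = h.attracting) : ∃ p : ℕ, 0 < p ∧ Commute k (g ^ p) := by
  obtain ⟨A, hA⟩ := h.1
  have hA0 : 0 ≤ A := (gromovProduct_nonneg _ _ _).trans (hA 0 0)
  obtain ⟨R, N, -, -, hRN⟩ := hacyl (dist (k • o) o + 2 * A + 4 * δ + 1) (by positivity)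
  obtain ⟨m, hm⟩ := (tendsto_atTop.1 h.2 R).exists
  have hfin := Set.finite_of_encard_le_coe (hRN o (g ^ m • o) (by rwa [dist_comm]))
  have hb : ∀ n i : ℕ, dist (g ^ i • o) (((g ^ n)⁻¹ * k * g ^ n) • g ^ i • o) ≤
      dist (k • o) o + 2 * A + 4 * δ + 1 := fun n i => by
    have := h.dist_smul_pow_le hδ hδ0 hA hk (n + i)
    rw [← dist_smul (g ^ n), mul_assoc, mul_smul, smul_inv_smul, mul_smul, ← mul_smul (g ^ n),
      ← pow_add]
    linarith
  -- All these conjugates displace the distant points `o` and `gᵐ o` boundedly, so acylindricity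
  -- makes two of them coincide.
  have hni : ¬ Function.Injective fun n : ℕ => (g ^ n)⁻¹ * k * g ^ n := fun hinj =>
    hfin.not_infinite (Set.infinite_of_injective_forall_mem hinj fun n =>
      ⟨by simpa using hb n 0, hb n m⟩)
  have key : ∀ a b : ℕ, a < b → (g ^ a)⁻¹ * k * g ^ a = (g ^ b)⁻¹ * k * g ^ b →
      ∃ p : ℕ, 0 < p ∧ Commute k (g ^ p) := fun a b hab he => by
    obtain ⟨p, rfl⟩ := Nat.exists_eq_add_of_lt hab
    refine ⟨p + 1, p.succ_pos, ?_⟩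
    rw [add_assoc, add_comm a, pow_add] at he
    have h2 : k = (g ^ (p + 1))⁻¹ * k * g ^ (p + 1) := by
      refine mul_left_cancel (a := (g ^ a)⁻¹) (mul_right_cancel (b := g ^ a) ?_)
      rw [he]
      simp only [mul_inv_rev, mul_assoc]
    rw [Commute, SemiconjBy]
    conv_rhs => rw [h2]
    group
  simp only [Function.Injective, not_forall] at hni
  obtain ⟨a, b, he, hne⟩ := hni
  rcases lt_or_gt_of_ne hne with hab | hab
  · exact key a b hab he
  · exact key b a hab he.symm

/-- In an acylindrical action, an element fixing one endpoint of a loxodromic element fixes the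
other one. -/
theorem smul_attracting_inv (hδ : IsGromovHyperbolic S δ) (hδ0 : 0 ≤ δ)
    (hacyl : IsAcylindricalAction G S) (h : IsLoxodromicAt o g) {k : G}
    (hk : k • h.attracting = h.attracting) : k • h.inv.attracting = h.inv.attracting := by
  obtain ⟨p, hp, hc⟩ := h.exists_commute_pow hδ hδ0 hacyl hk
  rw [h.inv.smul_attracting_eq_iff hδ]
  refine asymptotic_of_frequently_le hδ o (h.inv.asymptotic.smul k) h.inv.asymptotic fun M N => ?_
  obtain ⟨N', hN'⟩ := tendsto_atTop_atTop.1 h.inv.2 (M + dist (k • o) o)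
  have hle : max N N' ≤ p * max N N' := Nat.le_mul_of_pos_left _ hp
  -- Exponents divisible by `p` make `k` commute with the power, so it displaces that orbit point by
  -- `dist (k • o) o`.
  refine ⟨p * max N N', (le_max_left _ _).trans hle, p * max N N', (le_max_left _ _).trans hle, ?_⟩
  have h1 := hN' _ ((le_max_right _ _).trans hle)
  have h2 : k • g⁻¹ ^ (p * max N N') • o = g⁻¹ ^ (p * max N N') • k • o := by
    have : Commute k (g⁻¹ ^ (p * max N N')) := by
      rw [inv_pow, pow_mul]; exact (hc.pow_right _).inv_right
    rw [smul_smul, this.eq, mul_smul]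
  have h3 := gromovProduct_left_le (g⁻¹ ^ (p * max N N') • o) (g⁻¹ ^ (p * max N N') • k • o)
    (g⁻¹ ^ (p * max N N') • o) o
  rw [dist_smul, dist_comm o] at h3
  have h4 : gromovProduct (g⁻¹ ^ (p * max N N') • o) (g⁻¹ ^ (p * max N N') • o) o =
      dist (g⁻¹ ^ (p * max N N') • o) o := by
    simp only [gromovProduct, dist_self]; ring
  rw [h2]
  linarith

theorem attracting_inv_inv (h : IsLoxodromicAt o g) : h.inv.inv.attracting = h.attracting := by
  have : ∀ (g' : G) (h' : IsLoxodromicAt o g'), g' = g → h'.attracting = h.attracting := by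
    rintro _ _ rfl; rfl
  exact this _ _ (inv_inv g)

end IsLoxodromicAt

/-- A subgroup to which conjugates of its elements by powers of any group element return infinitely
often. -/
def IsConjRecurrent (H : Subgroup G) : Prop :=
  ∀ h ∈ H, ∀ g : G, ∃ᶠ n : ℕ in atTop, (g ^ n)⁻¹ * h * g ^ n ∈ H

variable (G) in
/-- The fixed points on the boundary of loxodromic elements. -/
def loxodromicPoints (o : S) : Set (GromovBoundary S) :=
  {ξ | ∃ (g : G) (h : IsLoxodromicAt o g), h.attracting = ξ}

/-- A recurrent subgroup fixing a boundary point fixes all endpoints of loxodromic elements. -/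
theorem IsConjRecurrent.le_fixingSubgroup (hδ : IsGromovHyperbolic S δ) (hδ0 : 0 ≤ δ)
    (hacyl : IsAcylindricalAction G S) {H : Subgroup G} (hH : IsConjRecurrent H)
    {ξ : GromovBoundary S} (hξ : ∀ h ∈ H, h • ξ = ξ) :
    H ≤ fixingSubgroup G (loxodromicPoints G o) := by
  intro h hh
  rw [mem_fixingSubgroup_iff]
  rintro _ ⟨f, hf, rfl⟩
  by_cases hξf : ξ = hf.inv.attracting
  · have := hf.inv.smul_attracting_inv hδ hδ0 hacyl (k := h) (hξf ▸ hξ h hh)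
    rwa [hf.attracting_inv_inv] at this
  by_contra hne
  rw [hf.smul_attracting_eq_iff hδ] at hne
  obtain ⟨B', N', hB'⟩ :=
    gromovProduct_le_of_not_asymptotic hδ o (hf.asymptotic.smul h) hf.asymptotic hne
  obtain ⟨y, rfl⟩ := Quot.exists_rep ξ
  obtain ⟨B, N, hB⟩ := gromovProduct_le_of_not_asymptotic hδ o y.2 hf.inv.asymptotic
    fun hc => hξf ((gromovBoundary_mk_eq_iff hδ _ _).2 hc)
  obtain ⟨n, hu, hnN, hn⟩ := ((hH h hh f).and_eventually ((eventually_ge_atTop (max N N')).and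
    (tendsto_atTop.1 hf.2 (|B| + |B'| + 2 * δ + dist (h • o) o + 1)))).exists
  have hyu := (gromovBoundary_mk_eq_iff hδ _ _).1 (hξ _ hu)
  rw [asymptoticAtInfinity_iff o] at hyu
  -- One copy of the distance pays for moving the base point to `f⁻ⁿ o`; the other remains as the
  -- bound in `h1`.
  obtain ⟨N₁, hN₁⟩ := hyu (2 * dist (f ^ n • o) o)
  have h0 : _ ≤ gromovProduct (((f ^ n)⁻¹ * h * f ^ n) • y.1 (max N N₁)) (y.1 (max N N₁)) o :=
    hN₁ (max N N₁) (le_max_right _ _) (max N N₁) (le_max_right _ _)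
  have hBi := hB (max N N₁) (le_max_left _ _) n ((le_max_left _ _).trans hnN)
  have hBn := hB' n ((le_max_right _ _).trans hnN) n ((le_max_right _ _).trans hnN)
  generalize y.1 (max N N₁) = z at h0 hBi
  have h1 : dist (f ^ n • o) o ≤ gromovProduct (h • f ^ n • z) (f ^ n • z) o := by
    have e := gromovProduct_base_le (((f ^ n)⁻¹ * h * f ^ n) • z) z o ((f ^ n)⁻¹ • o)
    have e' : f ^ n • ((f ^ n)⁻¹ * h * f ^ n) • z = h • f ^ n • z := by
      rw [smul_smul, mul_assoc, mul_inv_cancel_left, mul_smul]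
    rw [← gromovProduct_smul_smul, e', ← dist_smul_left_eq] at e
    linarith
  have h2 : dist (f ^ n • o) o - |B| ≤ gromovProduct (f ^ n • z) (f ^ n • o) o := by
    have e := gromovProduct_add_swap (f ^ n • z) (f ^ n • o) o
    have e' : gromovProduct o (f ^ n • z) (f ^ n • o) = gromovProduct z (f⁻¹ ^ n • o) o := by
      rw [gromovProduct_comm, ← gromovProduct_smul (f ^ n) z, inv_pow, smul_inv_smul]
    rw [e', dist_comm] at e
    linarith [le_abs_self B]
  have h3 : dist (f ^ n • o) o - |B| - dist (h • o) o ≤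
      gromovProduct (h • f ^ n • o) (h • f ^ n • z) o := by
    have e := gromovProduct_base_le (h • f ^ n • o) (h • f ^ n • z) (h • o) o
    rw [gromovProduct_smul, gromovProduct_comm] at e
    linarith
  have h4 : |B'| + 1 ≤ gromovProduct (h • f ^ n • o) (f ^ n • o) o := by
    have d0 := dist_nonneg (x := h • o) (y := o)
    refine hδ.le_gromovProduct (f ^ n • z) (hδ.le_gromovProduct (h • f ^ n • z) ?_ ?_) ?_
    · linarith
    · linarith [abs_nonneg B]
    · linarith
  linarith [le_abs_self B']

end Dynamics

/-! ### Density of loxodromic endpoints, and the finite radical as their pointwise stabiliser. -/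

section LimitSets

theorem limitSet_subgroup_subset {G : Type u} [Group G] {S : Type v} [MetricSpace S]
    [MulAction G S] (H : Subgroup G) : limitSet H S ⊆ limitSet G S := by
  rintro ξ ⟨s, x, hx, rfl⟩
  refine ⟨s, x, fun n => ?_, rfl⟩
  obtain ⟨h, hh⟩ := hx n
  exact ⟨h.1, hh⟩

variable {G : Type u} [Group G] {S : Type v} [MetricSpace S] [MulAction G S] [IsIsometricSMul G S]
  {δ : ℝ} {o : S}

/-- Boundary points whose Gromov product based at `o` is at least `M`, along every pair of
representatives. -/
def GromovBoundary.NearAt (o : S) (M : ℝ) (ξ η : GromovBoundary S) : Prop :=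
  ∀ x y : SeqAtInfinity S, Quot.mk _ x = ξ → Quot.mk _ y = η →
    ∃ N : ℕ, ∀ i ≥ N, ∀ j ≥ N, M ≤ gromovProduct (x.1 i) (y.1 j) o

theorem GromovBoundary.nearAt_mk (hδ : IsGromovHyperbolic S δ) {M : ℝ} {x y : SeqAtInfinity S}
    (h : ∃ N : ℕ, ∀ i ≥ N, ∀ j ≥ N, M + 2 * δ ≤ gromovProduct (x.1 i) (y.1 j) o) :
    GromovBoundary.NearAt o M (Quot.mk _ x) (Quot.mk _ y) := by
  intro x' y' hx hy
  rw [gromovBoundary_mk_eq_iff hδ, asymptoticAtInfinity_iff o] at hx hy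
  obtain ⟨N, hN⟩ := h
  obtain ⟨N₁, h₁⟩ := hx (M + 2 * δ)
  obtain ⟨N₂, h₂⟩ := hy (M + δ)
  refine ⟨max N (max N₁ N₂), fun i hi j hj => ?_⟩
  simp only [ge_iff_le, max_le_iff] at hi hj
  refine hδ.le_gromovProduct (y.1 j) (hδ.le_gromovProduct (x.1 i) ?_ ?_) ?_
  · linarith [h₁ i hi.2.1 i hi.2.1]
  · linarith [hN i hi.1 j hj.1]
  · rw [gromovProduct_comm]; exact h₂ j hj.2.2 j hj.2.2

theorem GromovBoundary.exists_not_nearAt (hδ : IsGromovHyperbolic S δ) (o : S)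
    {ξ η : GromovBoundary S} (h : ξ ≠ η) : ∃ B : ℝ, ¬ GromovBoundary.NearAt o B ξ η := by
  obtain ⟨x, rfl⟩ := Quot.exists_rep ξ
  obtain ⟨y, rfl⟩ := Quot.exists_rep η
  obtain ⟨B, N, hB⟩ := gromovProduct_le_of_not_asymptotic hδ o x.2 y.2
    (mt (gromovBoundary_mk_eq_iff hδ x y).2 h)
  refine ⟨B + 1, fun hn => ?_⟩
  obtain ⟨N', hN'⟩ := hn x y rfl rfl
  linarith [hB _ (le_max_left N N') _ (le_max_left N N'),
    hN' _ (le_max_right N N') _ (le_max_right N N')]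

/-- Criterion for a boundary point to be a limit of an orbit. -/
theorem mk_mem_limitSet (hδ : IsGromovHyperbolic S δ) (x : SeqAtInfinity S)
    (h : ∀ M : ℝ, ∃ (a : G) (N : ℕ), ∀ j ≥ N, M ≤ gromovProduct (a • o) (x.1 j) o) :
    (Quot.mk _ x : GromovBoundary S) ∈ limitSet G S := by
  choose a N ha using fun n : ℕ => h n
  have hxa : AsymptoticAtInfinity (fun n => a n • o) x.1 := by
    rw [asymptoticAtInfinity_iff o]
    intro M
    obtain ⟨N₁, h₁⟩ := (asymptoticAtInfinity_iff o _ _).1 x.2 (M + δ)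
    obtain ⟨N₂, h₂⟩ := exists_nat_ge (M + δ)
    refine ⟨max N₁ N₂, fun i hi j hj => hδ.le_gromovProduct (x.1 (max (N i) N₁)) ?_ ?_⟩
    · have : (N₂ : ℝ) ≤ i := by exact_mod_cast (le_max_right _ _).trans hi
      linarith [ha i _ (le_max_left (N i) N₁)]
    · exact h₁ _ (le_max_right _ _) j ((le_max_left _ _).trans hj)
  exact (mem_limitSet_iff o _).2 ⟨a, ⟨_, hxa.trans hδ hxa.symm⟩, fun n => rfl, Quot.sound hxa⟩

theorem smul_mem_loxodromicPoints {ξ : GromovBoundary S} (hξ : ξ ∈ loxodromicPoints G o) (a : G) :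
    a • ξ ∈ loxodromicPoints G o := by
  obtain ⟨g, h, rfl⟩ := hξ
  exact ⟨_, h.conj a, (h.smul_attracting a).symm⟩

/-- Limit points of an orbit are approximated by endpoints of loxodromic elements. -/
theorem exists_loxodromicPoint_nearAt (hδ : IsGromovHyperbolic S δ) (hδ0 : 0 ≤ δ)
    {g : G} (hg : IsLoxodromicAt o g) {ξ : GromovBoundary S} (hξ : ξ ∈ limitSet G S) (M : ℝ) :
    ∃ η ∈ loxodromicPoints G o, GromovBoundary.NearAt o M ξ η := by
  obtain ⟨a, x, hx, rfl⟩ := (mem_limitSet_iff o ξ).1 hξ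
  obtain ⟨A, hA⟩ := hg.1
  obtain ⟨n, hn⟩ := (asymptoticAtInfinity_iff o _ _).1 x.2 (M + 4 * δ + |M + 4 * δ| + |A|)
  -- The point `(a n)⁻¹ • o` cannot lie in the direction of both endpoints of `g`. With the right
  -- choice of `g` or `g⁻¹`, the translated half-orbit from `a n • o` does not turn back towards
  -- `o`.
  have key : ∃ (g' : G) (_ : IsLoxodromicAt o g'),
      ∀ j : ℕ, gromovProduct ((a n)⁻¹ • o) (g' ^ j • o) o ≤ A + δ := by
    by_cases hall : ∀ j : ℕ, gromovProduct ((a n)⁻¹ • o) (g ^ j • o) o ≤ A + δ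
    · exact ⟨g, hg, hall⟩
    · push Not at hall
      obtain ⟨i, hi⟩ := hall
      refine ⟨g⁻¹, hg.inv, fun j => ?_⟩
      rcases min_le_iff.1 (hδ (g ^ i • o) ((a n)⁻¹ • o) (g⁻¹ ^ j • o) o) with h | h
      · rw [gromovProduct_comm] at h
        linarith [hA i j]
      · linarith [hA i j]
  obtain ⟨g', hg', hb⟩ := key
  refine ⟨_, smul_mem_loxodromicPoints ⟨g', hg', rfl⟩ (a n), GromovBoundary.nearAt_mk hδ
    ⟨n, fun i hi j hj => ?_⟩⟩
  change _ ≤ gromovProduct (x.1 i) (a n • g' ^ j • o) o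
  have h1 := hn i hi n le_rfl
  have h2 := hn n le_rfl n le_rfl
  have h3 := gromovProduct_le_dist_left (x.1 n) (x.1 n) o
  have h4 := gromovProduct_add_swap (a n • g' ^ j • o) (a n • o) o
  have h5 : gromovProduct o (a n • g' ^ j • o) (a n • o) =
      gromovProduct ((a n)⁻¹ • o) (g' ^ j • o) o := by
    rw [← gromovProduct_smul (a n) ((a n)⁻¹ • o), smul_inv_smul]
  rw [h5, dist_comm, ← hx n] at h4
  refine hδ.le_gromovProduct (x.1 n) ?_ ?_
  · linarith [abs_nonneg A, abs_nonneg (M + 4 * δ)]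
  · rw [gromovProduct_comm]
    linarith [le_abs_self A, abs_nonneg (M + 4 * δ), hb j]

/-- Limit points are approximated by loxodromic endpoints; were these finitely many, every limit
point would be one of them. -/
theorem infinite_loxodromicPoints (hδ : IsGromovHyperbolic S δ) (hδ0 : 0 ≤ δ) (o : S)
    (hne : IsNonelementaryAction G S) : (loxodromicPoints G o).Infinite := by
  intro hfin
  obtain ⟨g, hg⟩ := exists_isLoxodromicAt hδ hδ0 o hne.nontrivial
  refine hne (hfin.subset fun ξ hξ => ?_)
  by_contra hn
  have hB : ∀ η : loxodromicPoints G o, ∃ B : ℝ, ¬ GromovBoundary.NearAt o B ξ η.1 := fun η =>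
    GromovBoundary.exists_not_nearAt hδ o fun h => hn (h ▸ η.2)
  choose B hB using hB
  have := hfin.to_subtype
  obtain ⟨M, hM⟩ := (Set.finite_range B).bddAbove
  obtain ⟨η, hη, hnear⟩ := exists_loxodromicPoint_nearAt hδ hδ0 hg hξ M
  refine hB ⟨η, hη⟩ fun x y hx hy => ?_
  obtain ⟨N, hN⟩ := hnear x y hx hy
  exact ⟨N, fun i hi j hj => (hM ⟨⟨η, hη⟩, rfl⟩).trans (hN i hi j hj)⟩

/-- Two points at which three points have small Gromov products are close. -/
theorem dist_le_of_gromovProduct_le (hδ : IsGromovHyperbolic S δ) {A : ℝ} {x y p q r : S}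
    (pqx : gromovProduct p q x ≤ A) (qrx : gromovProduct q r x ≤ A) (prx : gromovProduct p r x ≤ A)
    (pqy : gromovProduct p q y ≤ A) (qry : gromovProduct q r y ≤ A)
    (pry : gromovProduct p r y ≤ A) : dist x y ≤ 2 * A + 2 * δ := by
  by_contra! hlt
  -- If `x` and `y` are far apart, any two of `p`, `q`, `r` must lie strictly on opposite sides, one
  -- nearer `x` and one nearer `y`; three points cannot do so pairwise.
  have key : ∀ {a b : S}, gromovProduct a b x ≤ A → gromovProduct a b y ≤ A →
      (dist a x < dist a y ∨ dist b x < dist b y) ∧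
        (dist a y < dist a x ∨ dist b y < dist b x) := by
    intro a b h1 h2
    have h := hδ.dist_add_dist_le x y a b
    simp only [gromovProduct, dist_comm a x, dist_comm b x, dist_comm a y, dist_comm b y] at *
    rw [← sub_le_iff_le_add, le_max_iff] at h
    constructor
    · by_contra! hc
      rcases h with h | h <;> linarith [hc.1, hc.2]
    · by_contra! hc
      rcases h with h | h <;> linarith [hc.1, hc.2]
  have k1 := key pqx pqy
  have k2 := key qrx qry
  have k3 := key prx pry
  rcases k1 with ⟨h1 | h1, h2 | h2⟩ <;> rcases k2 with ⟨h3 | h3, h4 | h4⟩ <;>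
    rcases k3 with ⟨h5 | h5, h6 | h6⟩ <;> linarith

/-- A uniform bound for displacements of the isometries fixing three boundary points. -/
theorem exists_dist_le_of_smul_eq (hδ : IsGromovHyperbolic S δ) (o : S) {ξ η ζ : GromovBoundary S}
    (h1 : ξ ≠ η) (h2 : η ≠ ζ) (h3 : ξ ≠ ζ) :
    ∃ C : ℝ, ∀ k : G, k • ξ = ξ → k • η = η → k • ζ = ζ → dist o (k • o) ≤ C := by
  obtain ⟨x, hxξ⟩ := Quot.exists_rep ξ
  obtain ⟨y, hyη⟩ := Quot.exists_rep η
  obtain ⟨z, hzζ⟩ := Quot.exists_rep ζ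
  -- Since `k⁻¹` fixes `α` and `β`, moving the base point to `k • o` alters the eventual bound by at
  -- most `2δ`, uniformly in `k`.
  have bound : ∀ {α β : GromovBoundary S} {a b : SeqAtInfinity S}, Quot.mk _ a = α →
      Quot.mk _ b = β → α ≠ β → ∃ C : ℝ, ∀ k : G, k • α = α → k • β = β →
        ∀ᶠ i in atTop, gromovProduct (a.1 i) (b.1 i) (k • o) ≤ C := by
    rintro _ _ a b rfl rfl hab
    obtain ⟨B, N, hB⟩ := gromovProduct_le_of_not_asymptotic hδ o a.2 b.2
      (mt (gromovBoundary_mk_eq_iff hδ a b).2 hab)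
    refine ⟨B + 2 * δ, fun k ha hb => ?_⟩
    replace ha := (eq_inv_smul_iff.2 ha).symm
    replace hb := (eq_inv_smul_iff.2 hb).symm
    obtain ⟨N₁, h₁⟩ := (asymptoticAtInfinity_iff o _ _).1
      ((gromovBoundary_mk_eq_iff hδ _ _).1 ha) (B + 2 * δ + 1)
    obtain ⟨N₂, h₂⟩ := (asymptoticAtInfinity_iff o _ _).1
      ((gromovBoundary_mk_eq_iff hδ _ _).1 hb) (B + δ + 1)
    filter_upwards [eventually_ge_atTop N, eventually_ge_atTop N₁, eventually_ge_atTop N₂]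
      with i hi hi₁ hi₂
    have e₁ : _ ≤ gromovProduct (k⁻¹ • a.1 i) (a.1 i) o := h₁ i hi₁ i hi₁
    have e₂ : _ ≤ gromovProduct (k⁻¹ • b.1 i) (b.1 i) o := h₂ i hi₂ i hi₂
    have e₃ : gromovProduct (a.1 i) (b.1 i) (k • o) =
        gromovProduct (k⁻¹ • a.1 i) (k⁻¹ • b.1 i) o := by
      rw [gromovProduct_smul_smul, inv_inv]
    rw [e₃]
    have e₀ := hB i hi i hi
    rw [gromovProduct_comm] at e₁
    rcases min_le_iff.1 (hδ (a.1 i) (k⁻¹ • b.1 i) (b.1 i) o) with h | h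
    · rcases min_le_iff.1 (hδ (a.1 i) (k⁻¹ • a.1 i) (k⁻¹ • b.1 i) o) with h' | h' <;> linarith
    · linarith
  obtain ⟨C₁, b₁⟩ := bound hxξ hyη h1
  obtain ⟨C₂, b₂⟩ := bound hyη hzζ h2
  obtain ⟨C₃, b₃⟩ := bound hxξ hzζ h3
  refine ⟨2 * max C₁ (max C₂ C₃) + 2 * δ, fun k hx hy hz => ?_⟩
  have c₁ := b₁ 1 (one_smul _ _) (one_smul _ _)
  have c₂ := b₂ 1 (one_smul _ _) (one_smul _ _)
  have c₃ := b₃ 1 (one_smul _ _) (one_smul _ _)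
  rw [one_smul] at c₁ c₂ c₃
  obtain ⟨i, ⟨⟨i₁, i₂⟩, i₃⟩, ⟨i₄, i₅⟩, i₆⟩ := (((c₁.and c₂).and c₃).and
    (((b₁ k hx hy).and (b₂ k hy hz)).and (b₃ k hx hz))).exists
  have m₁ : C₁ ≤ max C₁ (max C₂ C₃) := le_max_left _ _
  have m₂ : C₂ ≤ max C₁ (max C₂ C₃) := (le_max_left _ _).trans (le_max_right _ _)
  have m₃ : C₃ ≤ max C₁ (max C₂ C₃) := (le_max_right _ _).trans (le_max_right _ _)
  exact dist_le_of_gromovProduct_le hδ (i₁.trans m₁) (i₂.trans m₂) (i₃.trans m₃) (i₄.trans m₁)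
    (i₅.trans m₂) (i₆.trans m₃)

theorem normal_fixingSubgroup_loxodromicPoints :
    (fixingSubgroup G (loxodromicPoints G o)).Normal := by
  refine ⟨fun n hn g => ?_⟩
  rw [mem_fixingSubgroup_iff] at *
  intro ξ hξ
  rw [mul_smul, mul_smul, hn _ (smul_mem_loxodromicPoints hξ g⁻¹), smul_inv_smul]

/-- The kernel of the action on the endpoints of loxodromic elements is finite. -/
theorem finite_fixingSubgroup_loxodromicPoints (hδ : IsGromovHyperbolic S δ) (hδ0 : 0 ≤ δ) (o : S)
    (hne : IsNonelementaryAction G S) (hacyl : IsAcylindricalAction G S) :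
    Finite (fixingSubgroup G (loxodromicPoints G o)) := by
  have hinf := infinite_loxodromicPoints hδ hδ0 o hne
  obtain ⟨ξ, hξ⟩ := hinf.nonempty
  obtain ⟨η, hη, hηξ⟩ := (hinf.sdiff (Set.finite_singleton ξ)).nonempty
  obtain ⟨ζ, hζ, hζn⟩ := (hinf.sdiff (Set.toFinite {ξ, η})).nonempty
  simp only [Set.mem_singleton_iff, Set.mem_insert_iff, not_or] at hηξ hζn
  obtain ⟨C, hC⟩ := exists_dist_le_of_smul_eq (G := G) hδ o (Ne.symm hηξ) (Ne.symm hζn.2)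
    (Ne.symm hζn.1)
  have hK : ∀ k ∈ fixingSubgroup G (loxodromicPoints G o), dist o (k • o) ≤ C := fun k hk => by
    rw [mem_fixingSubgroup_iff] at hk
    exact hC k (hk _ hξ) (hk _ hη) (hk _ hζ)
  obtain ⟨R, N, -, -, hRN⟩ := hacyl (|C| + 1) (by positivity)
  obtain ⟨g, hg, -⟩ := hξ
  obtain ⟨m, hm⟩ := (tendsto_atTop.1 hg.2 R).exists
  refine Set.Finite.to_subtype ((Set.finite_of_encard_le_coe
    (hRN o (g ^ m • o) (by rwa [dist_comm]))).subset fun k hk => ⟨?_, ?_⟩)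
  · linarith [hK k hk, le_abs_self C]
  -- By normality, the bound at `o` for the conjugate is the bound at `gᵐ o` for `k`.
  · have h1 := hK _ (normal_fixingSubgroup_loxodromicPoints.conj_mem k hk (g ^ m)⁻¹)
    rw [inv_inv, mul_smul, mul_smul, dist_comm, dist_smul_left_eq, inv_inv, dist_comm] at h1
    linarith [le_abs_self C]

/-- Moving an endpoint would give conjugates with unbounded displacement of `o`, all inside the
finite `N`. -/
theorem le_fixingSubgroup_of_finite_of_normal (hδ : IsGromovHyperbolic S δ) {N : Subgroup G}
    (hN : N.Normal) (hfin : Finite N) : N ≤ fixingSubgroup G (loxodromicPoints G o) := by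
  intro k hk
  rw [mem_fixingSubgroup_iff]
  rintro _ ⟨g, hg, rfl⟩
  by_contra hne
  obtain ⟨M, hM⟩ := (Set.finite_range fun n : N => dist (n.1 • o) o).bddAbove
  obtain ⟨n, hn⟩ := hg.le_gromovProduct_conj hδ hne (M + 1)
  have h1 := hn n le_rfl n le_rfl
  have h2 := hN.conj_mem k hk (g ^ n)⁻¹
  rw [inv_inv] at h2
  have h3 : _ ≤ M := hM ⟨⟨_, h2⟩, rfl⟩
  have h4 := gromovProduct_le_dist_left (((g ^ n)⁻¹ * k * g ^ n) • o) (g⁻¹ ^ n • o) o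
  linarith

theorem isGreatest_fixingSubgroup_loxodromicPoints (hδ : IsGromovHyperbolic S δ) (hδ0 : 0 ≤ δ)
    (o : S) (hne : IsNonelementaryAction G S) (hacyl : IsAcylindricalAction G S) :
    IsGreatest {N : Subgroup G | N.Normal ∧ Finite N}
      (fixingSubgroup G (loxodromicPoints G o)) :=
  ⟨⟨normal_fixingSubgroup_loxodromicPoints,
    finite_fixingSubgroup_loxodromicPoints hδ hδ0 o hne hacyl⟩,
    fun _ hN => le_fixingSubgroup_of_finite_of_normal hδ hN.1 hN.2⟩

/-- A recurrent subgroup moving some endpoint of a loxodromic element is geometrically dense. -/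
theorem IsConjRecurrent.isGeometricallyDense (hδ : IsGromovHyperbolic S δ) (hδ0 : 0 ≤ δ)
    (hne : IsNonelementaryAction G S) (hacyl : IsAcylindricalAction G S) {H : Subgroup G}
    (hH : IsConjRecurrent H) (hHK : ¬ H ≤ fixingSubgroup G (loxodromicPoints G o)) :
    IsGeometricallyDense H S := by
  have hfix : ∀ ξ : GromovBoundary S, ¬ ∀ h ∈ H, h • ξ = ξ := fun ξ hξ =>
    hHK (hH.le_fixingSubgroup hδ hδ0 hacyl hξ)
  refine ⟨fun ⟨ξ, hξ⟩ => hfix ξ hξ, (limitSet_subgroup_subset H).antisymm fun ξ hξ => ?_⟩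
  have : IsIsometricSMul H S := ⟨fun h => isometry_smul S h.1⟩
  have hlox : loxodromicPoints G o ⊆ limitSet H S := by
    rintro _ ⟨g, hg, rfl⟩
    -- Some `k ∈ H` moves `g⁻`, so `gⁿ k g⁻ⁿ o` tends to `g⁺`; recurrence along `g⁻¹` supplies such
    -- conjugates in `H`.
    have := hfix hg.inv.attracting
    push Not at this
    obtain ⟨k, hk, hkne⟩ := this
    refine mk_mem_limitSet (o := o) hδ _ fun M => ?_
    obtain ⟨N, hN⟩ := hg.inv.le_gromovProduct_conj hδ hkne M
    obtain ⟨n, hn, hnN⟩ := ((hH k hk g⁻¹).and_eventually (eventually_ge_atTop N)).exists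
    refine ⟨⟨_, hn⟩, n, fun j hj => ?_⟩
    have := hN n hnN j hj
    rw [inv_inv] at this
    exact this
  obtain ⟨g, hg⟩ := exists_isLoxodromicAt hδ hδ0 o hne.nontrivial
  obtain ⟨x, rfl⟩ := Quot.exists_rep ξ
  refine mk_mem_limitSet (o := o) hδ _ fun M => ?_
  obtain ⟨η, hη, hnear⟩ := exists_loxodromicPoint_nearAt hδ hδ0 hg hξ (M + δ)
  obtain ⟨a, y, hy, rfl⟩ := (mem_limitSet_iff o η).1 (hlox hη)
  obtain ⟨N, hN⟩ := hnear x y rfl rfl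
  refine ⟨a N, N, fun j hj => ?_⟩
  rw [← hy, gromovProduct_comm]
  exact (le_add_of_nonneg_right hδ0).trans (hN j hj N le_rfl)

/-- A recurrent subgroup not contained in the finite radical is geometrically dense. -/
theorem IsConjRecurrent.isTotallyGeometricallyDense {H : Subgroup G} (hH : IsConjRecurrent H)
    (hHK : ¬ H ≤ finiteRadical G) : IsTotallyGeometricallyDense.{u, w} H := by
  intro S _ _ _ hS hne hacyl
  obtain ⟨δ, hδ0, hδ⟩ := hS.exists_isGromovHyperbolic
  obtain ⟨_, s, -⟩ := hne.nonempty
  have hgr := isGreatest_fixingSubgroup_loxodromicPoints hδ hδ0 s hne hacyl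
  exact hH.isGeometricallyDense (o := s) hδ hδ0 hne hacyl fun h =>
    hHK (h.trans hgr.isLUB.sSup_eq.ge)

end LimitSets

theorem IsAcylindricallyHyperbolic.isGreatest_finiteRadical {G : Type u} [Group G]
    (hG : IsAcylindricallyHyperbolic.{u, v} G) :
    IsGreatest {N : Subgroup G | N.Normal ∧ Finite N} (finiteRadical G) := by
  obtain ⟨S, _, _, _, hS, hne, hacyl⟩ := hG
  obtain ⟨δ, hδ0, hδ⟩ := hS.exists_isGromovHyperbolic
  obtain ⟨_, s, -⟩ := hne.nonempty
  have hgr := isGreatest_fixingSubgroup_loxodromicPoints hδ hδ0 s hne hacyl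
  rwa [finiteRadical, hgr.isLUB.sSup_eq]

/-- A totally geometrically dense subgroup of an acylindrically hyperbolic group is acylindrically
hyperbolic. -/
theorem IsTotallyGeometricallyDense.isAcylindricallyHyperbolic {G : Type u} [Group G]
    (hG : IsAcylindricallyHyperbolic.{u, v} G) {H : Subgroup G}
    (hH : IsTotallyGeometricallyDense.{u, v} H) : IsAcylindricallyHyperbolic.{u, v} H := by
  obtain ⟨S, _, _, _, hS, hne, hacyl⟩ := hG
  refine ⟨S, inferInstance, inferInstance, ⟨fun h => isometry_smul S h.1⟩, hS, ?_, fun ε hε => ?_⟩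
  · have := (hH S hS hne hacyl).2
    rw [IsNonelementaryAction, this]
    exact hne
  · obtain ⟨R, N, hR, hN, hRN⟩ := hacyl ε hε
    refine ⟨R, N, hR, hN, fun x y hxy => le_trans ?_ (hRN x y hxy)⟩
    rw [← (Subtype.val_injective (p := fun g => g ∈ H)).encard_image]
    refine Set.encard_le_encard ?_
    rintro _ ⟨h, hh, rfl⟩
    exact hh

/-! ### Recurrence and the ergodic dichotomy. -/

section InvariantRandomSubgroups

variable {G : Type u} [Group G]

theorem measurableSet_setOf_mem (g : G) : MeasurableSet {H : Subgroup G | g ∈ H} := by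
  classical
  have hc : Continuous fun H : Subgroup G => decide (g ∈ H) := by
    have : Continuous fun (H : Subgroup G) (g : G) => decide (g ∈ H) := by
      convert continuous_induced_dom
    exact (continuous_apply g).comp this
  have : {H : Subgroup G | g ∈ H} = (fun H : Subgroup G => decide (g ∈ H)) ⁻¹' {true} := by
    ext H; simp
  rw [this]
  exact ((isOpen_discrete _).preimage hc).measurableSet

theorem mem_conjAct_smul_iff (c : ConjAct G) (H : Subgroup G) (g : G) :
    g ∈ c • H ↔ (ConjAct.ofConjAct c)⁻¹ * g * ConjAct.ofConjAct c ∈ H := by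
  rw [Subgroup.mem_pointwise_smul_iff_inv_smul_mem, ConjAct.smul_def, ConjAct.ofConjAct_inv,
    inv_inv]

theorem measurableConstSMul_conjAct_subgroup : MeasurableConstSMul (ConjAct G) (Subgroup G) := by
  classical
  refine ⟨fun c => Continuous.measurable ?_⟩
  rw [continuous_induced_rng, continuous_pi_iff]
  intro g
  have h1 : Continuous fun (H : Subgroup G) (g : G) => decide (g ∈ H) := by
    convert continuous_induced_dom
  refine ((continuous_apply ((ConjAct.ofConjAct c)⁻¹ * g * ConjAct.ofConjAct c)).comp h1).congr
    fun H => ?_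
  simp [mem_conjAct_smul_iff]

/-- Poincaré recurrence for invariant random subgroups. -/
theorem ae_isConjRecurrent [Countable G] (μ : Measure (Subgroup G)) [IsFiniteMeasure μ]
    [SMulInvariantMeasure (ConjAct G) (Subgroup G) μ] : ∀ᵐ H ∂μ, IsConjRecurrent H := by
  have := measurableConstSMul_conjAct_subgroup (G := G)
  have key : ∀ h g : G, ∀ᵐ H ∂μ, h ∈ H → ∃ᶠ n : ℕ in atTop, (g ^ n)⁻¹ * h * g ^ n ∈ H := by
    intro h g
    filter_upwards [(measurePreserving_smul (ConjAct.toConjAct g)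
      μ).conservative.ae_mem_imp_frequently_image_mem
        (measurableSet_setOf_mem h).nullMeasurableSet] with H hH hh
    refine (hH hh).mono fun n hn => ?_
    rw [smul_iterate] at hn
    exact (mem_conjAct_smul_iff _ _ _).1 hn
  -- Countability of `G` merges the null sets for all pairs `h`, `g`.
  filter_upwards [ae_all_iff.2 fun h => ae_all_iff.2 (key h)] with H hH h hh g
  exact hH h g hh

/-- An ergodic invariant random subgroup is almost surely contained in a given normal subgroup, or
almost surely not. -/
theorem IsErgodicIRS.ae_le_or_ae_not_le [Countable G] {μ : Measure (Subgroup G)}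
    (hμ : IsErgodicIRS μ) (K : Subgroup G) [hK : K.Normal] :
    (∀ᵐ H ∂μ, H ≤ K) ∨ ∀ᵐ H ∂μ, ¬ H ≤ K := by
  have := hμ.ergodicSMul
  have hm : MeasurableSet {H : Subgroup G | H ≤ K} := by
    have : {H : Subgroup G | H ≤ K} = ⋂ g ∈ (K : Set G)ᶜ, {H : Subgroup G | g ∈ H}ᶜ := by
      ext H
      simp only [Set.mem_ofPred_eq, Set.mem_iInter, Set.mem_compl_iff, SetLike.mem_coe]
      exact ⟨fun h g hg hgH => hg (h hgH), fun h g hg => by_contra fun hn => h g hn hg⟩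
    rw [this]
    exact MeasurableSet.biInter (Set.to_countable _) fun g _ => (measurableSet_setOf_mem g).compl
  have hinv : ∀ c : ConjAct G, (c • ·) ⁻¹' {H : Subgroup G | H ≤ K} = {H : Subgroup G | H ≤ K} := by
    intro c
    ext H
    simp only [Set.mem_preimage, Set.mem_ofPred_eq]
    constructor
    · intro h g hg
      have := @h (ConjAct.ofConjAct c * g * (ConjAct.ofConjAct c)⁻¹)
        ((mem_conjAct_smul_iff _ _ _).2 (by simpa [mul_assoc] using hg))
      simpa [mul_assoc] using hK.conj_mem _ this (ConjAct.ofConjAct c)⁻¹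
    · intro h g hg
      have := hK.conj_mem _ (h ((mem_conjAct_smul_iff _ _ _).1 hg)) (ConjAct.ofConjAct c)
      simpa [mul_assoc] using this
  have := aeconst_of_forall_preimage_smul_ae_eq (ConjAct G) (μ := μ) hm.nullMeasurableSet
    fun c => (hinv c).eventuallyEq
  exact eventuallyConst_set.1 this

end InvariantRandomSubgroups

theorem mainTheorem4 {G : Type u} [Group G] [Countable G]
    (hG : IsAcylindricallyHyperbolic.{u, v} G)
    (μ : Measure (Subgroup G)) (hμ : IsErgodicIRS μ) :
    IsGreatest {N : Subgroup G | N.Normal ∧ Finite N} (finiteRadical G) ∧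
    (((∀ᵐ H ∂μ, IsTotallyGeometricallyDense.{u, w} H) ∧
        (∀ᵐ H : Subgroup G ∂μ, IsAcylindricallyHyperbolic.{u, v} H)) ∨
      ((∀ᵐ H ∂μ, H ≤ finiteRadical G) ∧ (∀ᵐ H : Subgroup G ∂μ, Finite H))) := by
  have := hμ.isProbabilityMeasure
  have := hμ.ergodicSMul
  have hK := hG.isGreatest_finiteRadical
  have := hK.1.1
  refine ⟨hK, ?_⟩
  rcases hμ.ae_le_or_ae_not_le (finiteRadical G) with h | h
  · refine Or.inr ⟨h, ?_⟩
    filter_upwards [h] with H hH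
    have := hK.1.2
    exact Finite.of_injective _ (Subgroup.inclusion_injective hH)
  · refine Or.inl ⟨?_, ?_⟩
    · filter_upwards [h, ae_isConjRecurrent μ] with H hH hrec
      exact hrec.isTotallyGeometricallyDense hH
    · filter_upwards [h, ae_isConjRecurrent μ] with H hH hrec
      exact (hrec.isTotallyGeometricallyDense hH).isAcylindricallyHyperbolic hG
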